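/- Let $m\ge 1$ and $n\ge 0$ be integers. Let $s_m(n)$ be the sum, over all partitions $\lambda$ of $n$, of the different parts of $\lambda$ that occur at least $m$ times in $\lambda$ (each such part is counted once for $\lambda$, regardless of its multiplicity). For a partition $\lambda$ with largest part $\lambda_1$ (where $\lambda_1=0$ for the empty partition), let $m_\lambda(1)$ be the number of parts of $\lambda$ equal to $1$, let $w(\lambda)$ be the number of parts of $\lambda$ greater than $m_\lambda(1)$, and let the crank of $\lambda$ be $$cr(\lambda)=\begin{cases}\lambda_1 & \text{if } m_\lambda(1)=0,\\ w(\lambda)-m_\lambda(1) & \text{if } m_\lambda(1)>0.\end{cases}$$ Let $C(n)$ and $D(n)$ be the numbers of partitions $\lambda$ of $n$ with $cr(\lambda)\ge 0$ and $cr(\lambda)>0$, respectively, with the usual convention for $n=1$ that the crank values $-1,0,1$ are counted with the numbers $1,-1,1$; thus $C(1)=0$ (which is also the literal count) and $D(1)=1$ (whereas the literal count would be $0$). Put $s_m(x)=C(x)=D(x)=0$ for $x<0$. Then $$\text{(i)}\quad \sum_{j=0}^\infty (-1)^j s_m\!\left(n-\frac{j(j+1)}2\right)=\sum_{j=0}^\infty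 j\,C(n-mj),$$ $$\text{(ii)}\quad \sum_{j=1}^\infty (-1)^{j+1} s_m\!\left(n-\frac{j(j+1)}2\right)=\sum_{j=0}^\infty j\,D(n-mj).$$ -/

import Mathlib

namespace CrankIdentity

/-- `s m n`: the sum, over all partitions `lam` of `n`, of the different parts of `lam`
that occur at least `m` times in `lam` (each counted once per partition). -/
def s (m n : ℕ) : ℕ :=
  ∑ lam : n.Partition, ∑ a ∈ lam.parts.toFinset with m ≤ lam.parts.count a, a

/-- The number of parts equal to `1`. -/
def ones {n : ℕ} (lam : n.Partition) : ℕ := lam.parts.count 1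

/-- The number of parts (with multiplicity) greater than the number of ones. -/
def partsAboveOnes {n : ℕ} (lam : n.Partition) : ℕ :=
  (lam.parts.filter (fun a => ones lam < a)).card

/-- The Andrews-Garvan crank. The largest part `lam.parts.sup` is `0` for the empty partition. -/
def crank {n : ℕ} (lam : n.Partition) : ℤ :=
  if ones lam = 0 then (lam.parts.sup : ℤ) else (partsAboveOnes lam : ℤ) - (ones lam : ℤ)

/-- The number of partitions of `n` with nonnegative crank. The customary crank counts for `n = 1`,
namely `-1` for crank `0` and `1` for each of the cranks `1` and `-1`, give the same
value `-1 + 1 = 0` at `n = 1` as the literal count. -/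
def C (n : ℕ) : ℕ := (Finset.univ.filter (fun lam : n.Partition => 0 ≤ crank lam)).card

/-- The number of partitions of `n` with positive crank, with the customary convention that
the crank counts for `n = 1` are `-1` for crank `0` and `1` for each of the cranks `1` and `-1`,
so that the value at `n = 1` is `1`. -/
def D (n : ℕ) : ℕ :=
  if n = 1 then 1 else (Finset.univ.filter (fun lam : n.Partition => 0 < crank lam)).card

/-- Extension of a function on `ℕ` to `ℤ` by `0` at the negative integers. -/
def extend (f : ℕ → ℕ) (x : ℤ) : ℤ := if 0 ≤ x then (f x.toNat : ℤ) else 0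

end CrankIdentity

/-!
Write `k` for the number of parts `1` of a partition, `w(j)` for the number of parts exceeding `j`,
`p(n)` for the number of partitions of `n` and `T_j = j (j + 1) / 2`.

Removing `m` copies of a part `a` gives `s_m(n) = ∑ a, a * p(n - m a)`, so both identities follow
from `C(n) = ∑ j, (-1)^j p(n - T_j)` and `D(n) = p(n) - C(n)` by exchanging two finite sums.

The crank is at least `-r` exactly if `k ≤ w(k) + r`. Let `f_r(n)` count the partitions of `n` with
this property, so that `C = f_0`. Removing `r + 1` parts `1` from the remaining partitions leaves
those `μ` of `n - (r + 1)` with `w(k + r + 1) ≤ k`. By `partCount_above_le_eq`, the heart of the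
proof, their number is `f_(r+1)(n - (r + 1))`. Hence `f_r(n) = p(n) - f_(r+1)(n - (r + 1))`, and
iterating from `r = 0` gives the alternating sum for `C`. The same theorem with shift `0`, which
fails only for `n = 1`, gives `D(n) = p(n) - C(n)` for `n ≠ 1`; the crank convention for `n = 1` is
what makes this true there as well.

The theorem says that for `(s, n) ≠ (0, 1)` as many partitions of `n` satisfy `w(k + s) ≤ k` as
satisfy `k ≤ w(k) + s`. Let `d` be the number of rows of the largest `d × (d + s)` rectangle in the
Ferrers diagram; the first condition says that at least `d` parts `1` lie below it. Let `d` be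
likewise for the largest `d × (d + s + 1)` rectangle; the second condition says that at most `d + s`
parts `1` lie below that one. A bijection (`widen`) removes `d` parts `1`, uses them to widen the
first rectangle by a column, and trades the remaining parts `1`, in groups of `d + s + 1`, for parts
`d + s + 1`.
-/

namespace CrankIdentity

/-! ### Counting partitions as multisets -/

/-- The number of partitions of `n`, viewed as multisets of positive integers, that satisfy `P`. -/
noncomputable def partCount (n : ℕ) (P : Multiset ℕ → Prop) : ℕ :=
  {μ : Multiset ℕ | (∀ x ∈ μ, 0 < x) ∧ μ.sum = n ∧ P μ}.ncard

/-- The number of parts of `μ` (with multiplicity) that exceed `j`. -/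
def above (j : ℕ) (μ : Multiset ℕ) : ℕ := (μ.filter (fun a => j < a)).card

lemma card_filter_partition (n : ℕ) (P : Multiset ℕ → Prop) [DecidablePred P] :
    (Finset.univ.filter (fun lam : n.Partition => P lam.parts)).card = partCount n P := by
  rw [partCount, ← Set.ncard_coe_finset]
  refine Set.ncard_congr (fun lam _ => lam.parts) ?_ ?_ ?_
  · intro lam h
    exact ⟨fun x hx => lam.parts_pos hx, lam.parts_sum, by simpa using h⟩
  · intro a b _ _ h
    exact Nat.Partition.ext h
  · rintro μ ⟨h0, h1, h2⟩
    exact ⟨⟨μ, fun {i} hi => h0 i hi, h1⟩, by simpa using h2, rfl⟩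

lemma partCount_congr {n : ℕ} {P Q : Multiset ℕ → Prop}
    (h : ∀ μ : Multiset ℕ, (∀ x ∈ μ, 0 < x) → μ.sum = n → (P μ ↔ Q μ)) :
    partCount n P = partCount n Q := by
  unfold partCount
  congr 1
  ext μ
  simp only [Set.mem_ofPred_eq]
  constructor
  · rintro ⟨h0, h1, h2⟩
    exact ⟨h0, h1, (h μ h0 h1).1 h2⟩
  · rintro ⟨h0, h1, h2⟩
    exact ⟨h0, h1, (h μ h0 h1).2 h2⟩

lemma partCount_add_partCount_not (n : ℕ) (P : Multiset ℕ → Prop) :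
    partCount n P + partCount n (fun μ => ¬ P μ) = partCount n (fun _ => True) := by
  classical
  rw [← card_filter_partition, ← card_filter_partition, ← card_filter_partition,
    Finset.filter_true, Finset.card_filter_add_card_filter_not]

/-- Adding `m` further copies of the part `a` is a bijection onto the partitions in which `a`
occurs at least `m` times. -/
lemma partCount_add_replicate (n m a : ℕ) (ha : 0 < a) (P : Multiset ℕ → Prop) :
    partCount n (fun μ => P (μ + Multiset.replicate m a)) =
      partCount (n + m * a) (fun μ => m ≤ μ.count a ∧ P μ) := by
  unfold partCount
  refine Set.ncard_congr (fun μ _ => μ + Multiset.replicate m a) ?_ ?_ ?_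
  · rintro μ ⟨h0, h1, h2⟩
    refine ⟨?_, by simp [h1], by simp, h2⟩
    intro x hx
    rcases Multiset.mem_add.1 hx with h | h
    · exact h0 x h
    · rwa [Multiset.eq_of_mem_replicate h]
  · intro μ ν _ _ h
    exact add_right_cancel h
  · rintro μ ⟨h0, h1, h2, h3⟩
    obtain ⟨ν, rfl⟩ := Multiset.le_iff_exists_add.1 (Multiset.le_count_iff_replicate_le.1 h2)
    rw [add_comm] at h3
    refine ⟨ν, ⟨fun x hx => h0 x (by simp [hx]), ?_, h3⟩, add_comm _ _⟩
    simp at h1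
    omega

lemma partCount_le_count_of_lt {n m a : ℕ} (h : n < m * a) (P : Multiset ℕ → Prop) :
    partCount n (fun μ => m ≤ μ.count a ∧ P μ) = 0 := by
  unfold partCount
  convert Set.ncard_empty (Multiset ℕ)
  ext μ
  simp only [Set.mem_ofPred_eq, Set.mem_empty_iff_false, iff_false]
  rintro ⟨-, h1, h2, -⟩
  obtain ⟨ν, rfl⟩ := Multiset.le_iff_exists_add.1 (Multiset.le_count_iff_replicate_le.1 h2)
  simp at h1
  omega

/-! ### Durfee rectangles -/

/-- The Durfee dissections of shape `t` of the partitions of `n`: pairs `(α, β)` in which, for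
`d = α.card`, all parts of `α` are at least `d + t` and all parts of `β` are at most `d + t`. Thus
`α` holds the rows through the largest `d × (d + t)` rectangle in the Ferrers diagram of `α + β`,
and `β` the rows below it. -/
def durfee (t n : ℕ) : Set (Multiset ℕ × Multiset ℕ) :=
  {p | (∀ a ∈ p.1, p.1.card + t ≤ a) ∧ (∀ b ∈ p.2, 0 < b ∧ b ≤ p.1.card + t) ∧
    p.1.sum + p.2.sum = n}

lemma card_le_card_of_durfee {t n n' : ℕ} {p p' : Multiset ℕ × Multiset ℕ}
    (hp : p ∈ durfee t n) (hp' : p' ∈ durfee t n') (h : p.1 + p.2 = p'.1 + p'.2) :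
    p'.1.card ≤ p.1.card := by
  by_contra! hlt
  have h1 := congrArg (fun μ => (μ.filter (fun a => p'.1.card + t ≤ a)).card) h
  simp only [Multiset.filter_add, Multiset.card_add] at h1
  rw [Multiset.filter_eq_self.2 hp'.1] at h1
  have h2 : p.2.filter (fun a => p'.1.card + t ≤ a) = 0 := by
    rw [Multiset.filter_eq_nil]
    intro b hb
    have := (hp.2.1 b hb).2
    omega
  have h3 := Multiset.card_le_card (Multiset.filter_le (fun a => p'.1.card + t ≤ a) p.1)
  rw [h2, Multiset.card_zero] at h1
  omega

lemma le_of_durfee {t n n' : ℕ} {p p' : Multiset ℕ × Multiset ℕ}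
    (hp : p ∈ durfee t n) (hp' : p' ∈ durfee t n') (h : p.1 + p.2 = p'.1 + p'.2)
    (hc : p.1.card = p'.1.card) : p.1 ≤ p'.1 := by
  by_contra hne
  have hne' : ¬ p'.1 ≤ p.1 := fun hle => hne (Multiset.eq_of_le_of_card_le hle hc.le).ge
  rw [Multiset.le_iff_count] at hne hne'
  push Not at hne hne'
  obtain ⟨x, hx⟩ := hne
  obtain ⟨y, hy⟩ := hne'
  have hcx := congrArg (Multiset.count x) h
  have hcy := congrArg (Multiset.count y) h
  simp only [Multiset.count_add] at hcx hcy
  have x1 := hp.1 x (Multiset.count_pos.1 (by omega))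
  have x2 := hp'.2.1 x (Multiset.count_pos.1 (by omega))
  have y1 := hp'.1 y (Multiset.count_pos.1 (by omega))
  have y2 := hp.2.1 y (Multiset.count_pos.1 (by omega))
  -- A part that can lie on either side of the cut is the width of the rectangle.
  have : x = y := by omega
  subst this
  omega

lemma durfee_injOn (t n : ℕ) : Set.InjOn (fun p => p.1 + p.2) (durfee t n) := by
  intro p hp p' hp' h
  have hc := le_antisymm (card_le_card_of_durfee hp' hp (id (Eq.symm h)))
    (card_le_card_of_durfee hp hp' h)
  have h1 : p.1 = p'.1 :=
    le_antisymm (le_of_durfee hp hp' h hc) (le_of_durfee hp' hp (id (Eq.symm h)) hc.symm)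
  refine Prod.ext h1 ?_
  have h' : p.1 + p.2 = p'.1 + p'.2 := h
  rw [h1] at h'
  exact add_left_cancel h'

lemma exists_durfee (t : ℕ) {μ : Multiset ℕ} (hμ : ∀ x ∈ μ, 0 < x) :
    ∃ p ∈ durfee t μ.sum, p.1 + p.2 = μ := by
  -- `d` is the largest number for which at least `d` parts are at least `d + t`.
  let R : ℕ → Prop := fun d => d ≤ (μ.filter (fun a => d + t ≤ a)).card
  have hR0 : R 0 := Nat.zero_le _
  obtain ⟨d, hd, hmax⟩ : ∃ d, R d ∧ ¬ R (d + 1) := by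
    by_contra! hcon
    have hall : ∀ d, R d := fun d => Nat.rec hR0 hcon d
    have h1 : μ.card + 1 ≤ _ := hall (μ.card + 1)
    have h2 := Multiset.card_le_card
      (Multiset.filter_le (fun a => μ.card + 1 + t ≤ a) μ)
    omega
  simp only [R, not_le] at hd hmax
  obtain ⟨α, hα1, hα2, hαc⟩ : ∃ α, μ.filter (fun a => d + 1 + t ≤ a) ≤ α ∧
      α ≤ μ.filter (fun a => d + t ≤ a) ∧ α.card = d := by
    have hle : μ.filter (fun a => d + 1 + t ≤ a) ≤ μ.filter (fun a => d + t ≤ a) :=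
      Multiset.monotone_filter_right _ (fun a h => by omega)
    obtain ⟨ν, hν⟩ := Multiset.le_iff_exists_add.1 hle
    rw [hν, Multiset.card_add] at hd
    obtain ⟨κ, hκ⟩ := Multiset.card_pos_iff_exists_mem.1
      (show 0 < (Multiset.powersetCard (d - (μ.filter (fun a => d + 1 + t ≤ a)).card) ν).card by
        rw [Multiset.card_powersetCard]
        exact Nat.choose_pos (by omega))
    obtain ⟨hκ, hκc⟩ := Multiset.mem_powersetCard.1 hκ
    refine ⟨_ + κ, Multiset.le_add_right _ _, ?_, ?_⟩
    · rw [hν]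
      exact add_le_add_right hκ _
    · rw [Multiset.card_add, hκc]
      omega
  have hαμ : α ≤ μ := hα2.trans (Multiset.filter_le _ _)
  have hsum : α + (μ - α) = μ := add_tsub_cancel_of_le hαμ
  refine ⟨(α, μ - α), ⟨?_, ?_, ?_⟩, hsum⟩
  · intro a ha
    rw [hαc]
    exact (Multiset.mem_filter.1 (Multiset.mem_of_le hα2 ha)).2
  · intro b hb
    refine ⟨hμ b (Multiset.mem_of_le tsub_le_self hb), ?_⟩
    by_contra! hlt
    have h1 := Multiset.count_le_of_le b hα1
    rw [Multiset.count_filter_of_pos (by simp only [hαc] at hlt; omega)] at h1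
    have h2 := Multiset.count_pos.2 hb
    simp only [Multiset.count_sub] at h2
    omega
  · rw [← Multiset.sum_add, hsum]

/-- Every partition has exactly one Durfee dissection of each shape. -/
lemma partCount_eq_ncard_durfee (t n : ℕ) (P : Multiset ℕ → Prop) :
    partCount n P = {p ∈ durfee t n | P (p.1 + p.2)}.ncard := by
  symm
  refine Set.ncard_congr (fun p _ => p.1 + p.2) ?_ ?_ ?_
  · rintro p ⟨⟨h0, h1, h2⟩, h3⟩
    refine ⟨?_, by simpa using h2, h3⟩
    intro x hx
    rcases Multiset.mem_add.1 hx with h | h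
    · have := h0 x h
      have := Multiset.card_pos_iff_exists_mem.2 ⟨x, h⟩
      omega
    · exact (h1 x h).1
  · intro p p' hp hp' h
    exact durfee_injOn t n hp.1 hp'.1 h
  · rintro μ ⟨h0, h1, h2⟩
    obtain ⟨p, hp, rfl⟩ := exists_durfee t h0
    exact ⟨p, ⟨h1 ▸ hp, h2⟩, rfl⟩

lemma above_add (j : ℕ) (μ ν : Multiset ℕ) : above j (μ + ν) = above j μ + above j ν := by
  simp [above]

lemma above_le_card (j : ℕ) (μ : Multiset ℕ) : above j μ ≤ μ.card :=
  Multiset.card_le_card (Multiset.filter_le _ _)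

lemma above_eq_zero {j : ℕ} {μ : Multiset ℕ} (h : ∀ x ∈ μ, x ≤ j) : above j μ = 0 := by
  rw [above, Multiset.card_eq_zero, Multiset.filter_eq_nil]
  exact fun x hx => (h x hx).not_gt

lemma above_eq_card {j : ℕ} {μ : Multiset ℕ} (h : ∀ x ∈ μ, j < x) : above j μ = μ.card := by
  rw [above, Multiset.filter_eq_self.2 h]

/-- The condition `w(k + s) ≤ k` read off the Durfee dissection of shape `s`. The rectangle contains
no part `1` unless it is a `1 × 1` square; when it does, all parts are `1` and both
sides hold, except that the right side fails for the excluded partition `1` of `1`. -/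
lemma above_le_count_one_iff {s n : ℕ} (hs : s ≠ 0 ∨ n ≠ 1) {p : Multiset ℕ × Multiset ℕ}
    (hp : p ∈ durfee s n) :
    above ((p.1 + p.2).count 1 + s) (p.1 + p.2) ≤ (p.1 + p.2).count 1 ↔
      p.1.card ≤ p.2.count 1 := by
  obtain ⟨α, β⟩ := p
  obtain ⟨h0, h1, h2⟩ := hp
  simp only at h0 h1 h2 ⊢
  by_cases hα : 1 ∈ α
  · -- Then the rectangle is the `1 × 1` square and all parts are `1`.
    have ha := h0 1 hα
    have hc := Multiset.card_pos_iff_exists_mem.2 ⟨1, hα⟩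
    have hα1 : α = {1} := by
      obtain ⟨a, rfl⟩ := Multiset.card_eq_one.1 (show α.card = 1 by omega)
      simpa [eq_comm] using hα
    have hβ : β = Multiset.replicate β.card 1 :=
      Multiset.eq_replicate_card.2 (fun b hb => by have := h1 b hb; omega)
    have hz : above ((α + β).count 1 + s) (α + β) = 0 := by
      refine above_eq_zero (fun x hx => ?_)
      have : 0 < (α + β).count 1 := Multiset.count_pos.2 (by simp [hα])
      rcases Multiset.mem_add.1 hx with h | h
      · rw [hα1] at h
        have := Multiset.mem_singleton.1 h
        omega
      · have := h1 x h
        omega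
    rw [hz]
    rw [hβ] at h2 ⊢
    simp [hα1] at h2 ⊢
    omega
  · have hk : (α + β).count 1 = β.count 1 := by
      rw [Multiset.count_add, Multiset.count_eq_zero_of_notMem hα, zero_add]
    rw [hk, above_add]
    constructor
    · intro h
      by_contra! hlt
      rw [above_eq_card (μ := α) (fun x hx => by have := h0 x hx; omega)] at h
      omega
    · intro h
      rw [above_eq_zero (μ := β) (fun x hx => by have := h1 x hx; omega)]
      have := above_le_card (β.count 1 + s) α
      omega

/-- The condition `k ≤ w(k) + s` read off the Durfee dissection of shape `s + 1`, whose rectangle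
never contains a part `1`. -/
lemma count_one_le_above_iff {s n : ℕ} {p : Multiset ℕ × Multiset ℕ}
    (hp : p ∈ durfee (s + 1) n) :
    (p.1 + p.2).count 1 ≤ above ((p.1 + p.2).count 1) (p.1 + p.2) + s ↔
      p.2.count 1 ≤ p.1.card + s := by
  obtain ⟨α, β⟩ := p
  obtain ⟨h0, h1, h2⟩ := hp
  simp only at h0 h1 h2 ⊢
  have hα : 1 ∉ α := fun h => by
    have := h0 1 h
    have := Multiset.card_pos_iff_exists_mem.2 ⟨1, h⟩
    omega
  have hk : (α + β).count 1 = β.count 1 := by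
    rw [Multiset.count_add, Multiset.count_eq_zero_of_notMem hα, zero_add]
  rw [hk, above_add]
  constructor
  · intro h
    by_contra! hlt
    rw [above_eq_zero (μ := β) (fun x hx => by have := h1 x hx; omega)] at h
    have := above_le_card (β.count 1) α
    omega
  · intro h
    rw [above_eq_card (μ := α) (fun x hx => by have := h0 x hx; omega)]
    omega

/-! ### Widening the Durfee rectangle -/

/-- Widens the rectangle of a Durfee dissection of shape `s` by one column, paid for with one part
`1` per row, and then trades the remaining parts `1`, in groups of `e + 1`, for parts `e + 1`,
where `e` is the former width. -/
def widen (s : ℕ) (p : Multiset ℕ × Multiset ℕ) : Multiset ℕ × Multiset ℕ :=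
  (p.1.map (· + 1),
    p.2.filter (fun b => 1 < b) +
      (Multiset.replicate ((p.2.count 1 - p.1.card) % (p.1.card + s + 1)) 1 +
        Multiset.replicate ((p.2.count 1 - p.1.card) / (p.1.card + s + 1)) (p.1.card + s + 1)))

/-- The inverse of `widen`. -/
def narrow (s : ℕ) (p : Multiset ℕ × Multiset ℕ) : Multiset ℕ × Multiset ℕ :=
  (p.1.map (· - 1),
    p.2.filter (fun b => 1 < b ∧ b ≤ p.1.card + s) +
      Multiset.replicate
        (p.2.count 1 + (p.1.card + s + 1) * p.2.count (p.1.card + s + 1) + p.1.card) 1)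

lemma sum_eq_sum_filter_add_count_one {β : Multiset ℕ} (h : ∀ b ∈ β, 0 < b) :
    β.sum = (β.filter (fun b => 1 < b)).sum + β.count 1 := by
  conv_lhs => rw [← Multiset.filter_add_not (fun b => 1 < b) β]
  rw [Multiset.sum_add, Multiset.filter_congr (p := fun b => ¬ 1 < b) (q := fun b => b = 1)
    (fun b hb => by have := h b hb; omega), Multiset.filter_eq']
  simp

lemma sum_map_add_one (α : Multiset ℕ) : (α.map (· + 1)).sum = α.sum + α.card := by
  simp [Multiset.sum_map_add]

lemma map_sub_one_map_add_one (α : Multiset ℕ) : (α.map (· + 1)).map (· - 1) = α := by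
  simp

lemma map_add_one_map_sub_one {α : Multiset ℕ} (h : ∀ a ∈ α, 0 < a) :
    (α.map (· - 1)).map (· + 1) = α := by
  rw [Multiset.map_map]
  conv_rhs => rw [← Multiset.map_id α]
  exact Multiset.map_congr rfl (fun a ha => Nat.sub_add_cancel (h a ha))

/-- The dissections with enough parts `1` to widen the rectangle. -/
def widenable (s n : ℕ) : Set (Multiset ℕ × Multiset ℕ) :=
  {p ∈ durfee s n | p.1.card ≤ p.2.count 1}

/-- The dissections obtained by widening. -/
def widened (s n : ℕ) : Set (Multiset ℕ × Multiset ℕ) :=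
  {p ∈ durfee (s + 1) n | p.2.count 1 ≤ p.1.card + s}

lemma widen_mapsTo (s n : ℕ) : Set.MapsTo (widen s) (widenable s n) (widened s n) := by
  rintro ⟨α, β⟩ ⟨⟨h0, h1, h2⟩, h3⟩
  simp only at h0 h1 h2 h3
  have hmod := Nat.mod_lt (β.count 1 - α.card) (show 0 < α.card + s + 1 by omega)
  refine ⟨⟨?_, ?_, ?_⟩, ?_⟩
  · intro a ha
    simp only [widen, Multiset.mem_map, Multiset.card_map] at ha ⊢
    obtain ⟨b, hb, rfl⟩ := ha
    have := h0 b hb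
    omega
  · intro b hb
    simp only [widen, Multiset.mem_add, Multiset.mem_filter, Multiset.card_map] at hb ⊢
    rcases hb with hb | hb | hb
    · have := h1 b hb.1
      omega
    · have := Multiset.eq_of_mem_replicate hb
      omega
    · have := Multiset.eq_of_mem_replicate hb
      omega
  · have hdm := Nat.mod_add_div (β.count 1 - α.card) (α.card + s + 1)
    rw [sum_eq_sum_filter_add_count_one (fun b hb => (h1 b hb).1)] at h2
    simp only [widen, sum_map_add_one, Multiset.sum_add, Multiset.sum_replicate, smul_eq_mul,
      mul_one]
    rw [mul_comm (_ / _)]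
    omega
  · simp only [widen, Multiset.count_add, Multiset.card_map, Multiset.count_replicate,
      Multiset.count_filter, lt_irrefl, if_false, if_true, zero_add]
    split_ifs with h
    · have hβ : β = 0 := Multiset.eq_zero_of_forall_notMem (fun b hb => by
        have := h1 b hb
        omega)
      simp [hβ]
    · omega

lemma narrow_sum {e : ℕ} {β : Multiset ℕ} (h : ∀ b ∈ β, 0 < b ∧ b ≤ e + 1)
    (h1 : β.count 1 ≤ e) :
    β.sum = (β.filter (fun b => 1 < b ∧ b ≤ e)).sum + (β.count 1 + (e + 1) * β.count (e + 1)) := by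
  have hβ : β = β.filter (fun b => 1 < b ∧ b ≤ e) +
      (Multiset.replicate (β.count 1) 1 + Multiset.replicate (β.count (e + 1)) (e + 1)) := by
    ext x
    simp only [Multiset.count_add, Multiset.count_filter, Multiset.count_replicate]
    by_cases hx : x ∈ β
    · have := h x hx
      have hx1 : x = 1 ∨ x = e + 1 ∨ (1 < x ∧ x ≤ e) := by omega
      have he : e ≠ 0 := by
        rintro rfl
        have : x = 1 := by omega
        subst this
        have := Multiset.count_pos.2 hx
        omega
      rcases hx1 with rfl | rfl | hx1
      · simp [he]
      · simp [he]
      · rw [if_pos hx1, if_neg (by omega), if_neg (by omega)]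
        omega
    · rw [Multiset.count_eq_zero_of_notMem hx]
      symm
      simp only [ite_self, zero_add, Nat.add_eq_zero_iff, ite_eq_right_iff]
      constructor
      · rintro rfl
        exact Multiset.count_eq_zero_of_notMem hx
      · rintro rfl
        exact Multiset.count_eq_zero_of_notMem hx
  conv_lhs => rw [hβ]
  simp [mul_comm]

lemma narrow_mapsTo (s n : ℕ) : Set.MapsTo (narrow s) (widened s n) (widenable s n) := by
  rintro ⟨α, β⟩ ⟨⟨h0, h1, h2⟩, h3⟩
  simp only at h0 h1 h2 h3
  have hpos : ∀ a ∈ α, 0 < a := fun a ha => by have := h0 a ha; omega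
  refine ⟨⟨?_, ?_, ?_⟩, ?_⟩
  · intro a ha
    simp only [narrow, Multiset.mem_map, Multiset.card_map] at ha ⊢
    obtain ⟨b, hb, rfl⟩ := ha
    have := h0 b hb
    omega
  · intro b hb
    simp only [narrow, Multiset.mem_add, Multiset.mem_filter, Multiset.card_map] at hb ⊢
    rcases hb with hb | hb
    · omega
    · obtain ⟨hne, rfl⟩ := Multiset.mem_replicate.1 hb
      refine ⟨one_pos, ?_⟩
      -- If the width were `0`, there would be no parts at all.
      by_contra! hlt
      have he : α.card + s = 0 := by omega
      have hβ : β.count 1 = 0 := by omega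
      apply hne
      have : α.card = 0 := by omega
      rw [he, zero_add, hβ, this]
  · have hs := narrow_sum (e := α.card + s) (fun b hb => by have := h1 b hb; omega) h3
    have ha := sum_map_add_one (α.map (· - 1))
    rw [map_add_one_map_sub_one hpos, Multiset.card_map] at ha
    simp only [narrow, Multiset.sum_add, Multiset.sum_replicate, smul_eq_mul, mul_one]
    omega
  · simp only [narrow, Multiset.count_add, Multiset.card_map, Multiset.count_replicate, if_true]
    omega

lemma narrow_widen {s n : ℕ} {p : Multiset ℕ × Multiset ℕ} (hp : p ∈ widenable s n) :
    narrow s (widen s p) = p := by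
  obtain ⟨α, β⟩ := p
  obtain ⟨⟨h0, h1, h2⟩, h3⟩ := hp
  simp only at h0 h1 h2 h3
  refine Prod.ext (map_sub_one_map_add_one α) ?_
  have hdm := Nat.mod_add_div (β.count 1 - α.card) (α.card + s + 1)
  ext x
  simp only [narrow, widen, Multiset.card_map, Multiset.count_add, Multiset.count_filter,
    Multiset.count_replicate]
  by_cases he : α.card + s = 0
  · have hβ : β = 0 := Multiset.eq_zero_of_forall_notMem (fun b hb => by
      have := h1 b hb
      omega)
    have : α.card = 0 := by omega
    simp [hβ, this]
  · have hw : β.count (α.card + s + 1) = 0 := Multiset.count_eq_zero_of_notMem (fun hb => by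
      have := h1 _ hb
      omega)
    by_cases hx1 : x = 1
    · subst hx1
      simp only [lt_irrefl, false_and, if_false, if_true, zero_add, hw, ite_self,
        if_neg (show ¬ α.card + s + 1 = 1 by omega), if_neg (show ¬ 1 = α.card + s + 1 by omega)]
      rw [add_zero, hdm]
      omega
    · have h0x : ¬ (1 < x ∧ x ≤ α.card + s) → β.count x = 0 := fun hx =>
        Multiset.count_eq_zero_of_notMem (fun hb => by have := h1 _ hb; omega)
      by_cases hx : 1 < x ∧ x ≤ α.card + s
      · rw [if_pos hx, if_pos hx.1, if_neg (Ne.symm hx1), if_neg (by omega), if_neg (by omega)]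
        omega
      · rw [if_neg hx, if_neg (Ne.symm hx1), h0x hx]

lemma widen_narrow {s n : ℕ} {p : Multiset ℕ × Multiset ℕ} (hp : p ∈ widened s n) :
    widen s (narrow s p) = p := by
  obtain ⟨α, β⟩ := p
  obtain ⟨⟨h0, h1, h2⟩, h3⟩ := hp
  simp only at h0 h1 h2 h3
  refine Prod.ext (map_add_one_map_sub_one (fun a ha => by have := h0 a ha; omega)) ?_
  have hc : (narrow s (α, β)).2.count 1 - α.card =
      β.count 1 + (α.card + s + 1) * β.count (α.card + s + 1) := by
    simp [narrow]
  have hmod : (β.count 1 + (α.card + s + 1) * β.count (α.card + s + 1)) % (α.card + s + 1) =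
      β.count 1 := by
    rw [Nat.add_mul_mod_self_left, Nat.mod_eq_of_lt (by omega)]
  have hdiv : (β.count 1 + (α.card + s + 1) * β.count (α.card + s + 1)) / (α.card + s + 1) =
      β.count (α.card + s + 1) := by
    rw [Nat.add_mul_div_left _ _ (by omega), Nat.div_eq_of_lt (by omega), zero_add]
  have hcard : (narrow s (α, β)).1.card = α.card := by simp [narrow]
  simp only [widen, hcard, hc, hmod, hdiv]
  ext x
  simp only [narrow, Multiset.count_add, Multiset.count_filter, Multiset.count_replicate]
  by_cases hx1 : x = 1
  · subst hx1
    by_cases he : α.card + s = 0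
    · have : β.count 1 = 0 := by omega
      simp [he, this]
    · simp only [lt_irrefl, false_and, if_false, if_true, zero_add,
        if_neg (show ¬ α.card + s + 1 = 1 by omega), add_zero]
  · have h0x : ¬ (1 < x ∧ x ≤ α.card + s + 1) → β.count x = 0 := fun hx =>
      Multiset.count_eq_zero_of_notMem (fun hb => by have := h1 _ hb; omega)
    simp only [if_neg (Ne.symm hx1), zero_add, add_zero]
    by_cases hx : x = α.card + s + 1
    · subst hx
      simp
    · rw [if_neg (Ne.symm hx), add_zero]
      by_cases hx2 : 1 < x ∧ x ≤ α.card + s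
      · rw [if_pos hx2.1, if_pos hx2]
      · rw [h0x (by omega), if_neg hx2, ite_self]

/-- A form of the symmetry of the crank. -/
theorem partCount_above_le_eq {s n : ℕ} (hs : s ≠ 0 ∨ n ≠ 1) :
    partCount n (fun μ => above (μ.count 1 + s) μ ≤ μ.count 1) =
      partCount n (fun μ => μ.count 1 ≤ above (μ.count 1) μ + s) := by
  have hl : {p ∈ durfee s n | above ((p.1 + p.2).count 1 + s) (p.1 + p.2) ≤ (p.1 + p.2).count 1} =
      widenable s n := by
    ext p
    exact and_congr_right (fun hp => above_le_count_one_iff hs hp)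
  have hr : {p ∈ durfee (s + 1) n |
      (p.1 + p.2).count 1 ≤ above ((p.1 + p.2).count 1) (p.1 + p.2) + s} = widened s n := by
    ext p
    exact and_congr_right (fun hp => count_one_le_above_iff hp)
  rw [partCount_eq_ncard_durfee s, partCount_eq_ncard_durfee (s + 1), hl, hr]
  exact (Set.InvOn.bijOn ⟨fun _ hp => narrow_widen hp, fun _ hp => widen_narrow hp⟩
    (widen_mapsTo s n) (narrow_mapsTo s n)).ncard_eq

/-! ### Recurrence for the crank counts -/

/-- The number of all partitions of `n`. -/
noncomputable def numPartitions (n : ℕ) : ℕ := partCount n (fun _ => True)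

/-- The number of partitions of `n` with crank at least `-r`, the crank of `1` being `-1`. -/
noncomputable def crankGe (r n : ℕ) : ℕ :=
  partCount n (fun μ => μ.count 1 ≤ above (μ.count 1) μ + r)

lemma above_replicate_one {j : ℕ} (hj : 0 < j) (m : ℕ) :
    above j (Multiset.replicate m 1) = 0 :=
  above_eq_zero (fun x hx => by rw [Multiset.eq_of_mem_replicate hx]; exact hj)

lemma partCount_crank_lt (r n : ℕ) :
    partCount (n + (r + 1)) (fun μ => ¬ μ.count 1 ≤ above (μ.count 1) μ + r) =
      crankGe (r + 1) n := by
  have h := partCount_add_replicate n (r + 1) 1 one_pos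
    (fun μ => ¬ μ.count 1 ≤ above (μ.count 1) μ + r)
  rw [mul_one] at h
  rw [crankGe, ← partCount_above_le_eq (Or.inl (Nat.succ_ne_zero r)),
    partCount_congr (Q := fun μ => r + 1 ≤ μ.count 1 ∧ ¬ μ.count 1 ≤ above (μ.count 1) μ + r)
      (fun μ _ _ => by omega), ← h]
  refine partCount_congr (fun μ _ _ => ?_)
  rw [Multiset.count_add, Multiset.count_replicate_self, above_add,
    above_replicate_one (by omega)]
  simp only [Nat.succ_eq_add_one]
  omega

lemma partCount_crank_lt_of_lt {r n : ℕ} (h : n < r + 1) :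
    partCount n (fun μ => ¬ μ.count 1 ≤ above (μ.count 1) μ + r) = 0 := by
  rw [← partCount_le_count_of_lt (m := r + 1) (a := 1) (n := n) (by omega)
    (fun μ => ¬ μ.count 1 ≤ above (μ.count 1) μ + r)]
  exact partCount_congr (fun μ _ _ => by omega)

/-! ### The alternating sum for the crank counts -/

lemma extend_of_neg (f : ℕ → ℕ) {x : ℤ} (hx : x < 0) : extend f x = 0 := if_neg (not_le.2 hx)

lemma extend_natCast (f : ℕ → ℕ) (n : ℕ) : extend f n = f n := by simp [extend]

lemma extend_sub_natCast (f : ℕ → ℕ) (n k : ℕ) :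
    extend f ((n : ℤ) - k) = if k ≤ n then (f (n - k) : ℤ) else 0 := by
  split_ifs with h
  · rw [← Nat.cast_sub h, extend_natCast]
  · exact extend_of_neg f (by omega)

lemma extend_crankGe (r : ℕ) (x : ℤ) :
    extend (crankGe r) x = extend numPartitions x - extend (crankGe (r + 1)) (x - (r + 1)) := by
  rcases lt_or_ge x 0 with hx | hx
  · rw [extend_of_neg _ hx, extend_of_neg _ hx, extend_of_neg _ (by omega), sub_zero]
  · lift x to ℕ using hx
    have h := partCount_add_partCount_not x (fun μ => μ.count 1 ≤ above (μ.count 1) μ + r)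
    rw [extend_natCast, extend_natCast, ← Nat.cast_succ, extend_sub_natCast, numPartitions, ← h]
    split_ifs with hr
    · obtain ⟨y, rfl⟩ := Nat.exists_eq_add_of_le' hr
      rw [Nat.add_sub_cancel, ← partCount_crank_lt, crankGe]
      push_cast
      ring
    · rw [partCount_crank_lt_of_lt (by omega), crankGe]
      simp

lemma triangle_succ (j : ℕ) :
    ((j + 1 : ℕ) : ℤ) * (((j + 1 : ℕ) : ℤ) + 1) / 2 = (j : ℤ) * (j + 1) / 2 + (j + 1) := by
  rw [show ((j + 1 : ℕ) : ℤ) * (((j + 1 : ℕ) : ℤ) + 1) = (j : ℤ) * (j + 1) + (j + 1) * 2 by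
    push_cast; ring, Int.add_mul_ediv_right _ _ (by norm_num)]

lemma le_triangle (j : ℕ) : (j : ℤ) ≤ (j : ℤ) * (j + 1) / 2 := by
  induction j with
  | zero => simp
  | succ j ih =>
    rw [triangle_succ]
    push_cast
    omega

lemma extend_crankGe_zero_eq_add (x : ℤ) (K : ℕ) :
    extend (crankGe 0) x =
      ∑ j ∈ Finset.range K, (-1 : ℤ) ^ j * extend numPartitions (x - (j : ℤ) * (j + 1) / 2) +
        (-1) ^ K * extend (crankGe K) (x - (K : ℤ) * (K + 1) / 2) := by
  induction K with
  | zero => simp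
  | succ K ih =>
    rw [ih, Finset.sum_range_succ, extend_crankGe K, triangle_succ, sub_sub x]
    ring

lemma extend_crankGe_zero (x : ℤ) {K : ℕ} (hK : x < K) :
    extend (crankGe 0) x =
      ∑ j ∈ Finset.range K, (-1 : ℤ) ^ j * extend numPartitions (x - (j : ℤ) * (j + 1) / 2) := by
  rw [extend_crankGe_zero_eq_add x K, extend_of_neg _ (by have := le_triangle K; omega), mul_zero,
    add_zero]

lemma C_eq_crankGe (n : ℕ) : C n = crankGe 0 n := by
  rw [crankGe, ← card_filter_partition, C]
  congr 1
  refine Finset.filter_congr (fun lam _ => ?_)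
  have h : partsAboveOnes lam = above (lam.parts.count 1) lam.parts := rfl
  rw [crank, ← h, ones]
  split_ifs with h0
  · simp [h0]
  · omega

lemma crank_pos_iff {n : ℕ} (lam : n.Partition) :
    0 < crank lam ↔ lam.parts.count 1 < above (lam.parts.count 1) lam.parts := by
  have h : partsAboveOnes lam = above (lam.parts.count 1) lam.parts := rfl
  rw [crank, ← h, ones]
  split_ifs with h0
  · rw [h, h0, above_eq_card (fun x hx => lam.parts_pos hx), Nat.cast_pos,
      Multiset.card_pos_iff_exists_mem]
    constructor
    · intro hs
      by_contra! hne
      rw [Multiset.eq_zero_of_forall_notMem hne] at hs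
      exact lt_irrefl _ hs
    · rintro ⟨x, hx⟩
      exact (lam.parts_pos hx).trans_le (Multiset.le_sup hx)
  · omega

lemma D_add_C (n : ℕ) : D n + C n = numPartitions n := by
  rw [D]
  split_ifs with hn
  · subst hn
    have h1 : numPartitions 1 = 1 := by
      rw [numPartitions, ← card_filter_partition, Finset.filter_true, Finset.card_univ]
      exact Fintype.card_unique
    have h2 : C 1 = 0 := by
      rw [C, Finset.card_eq_zero, Finset.filter_eq_empty_iff]
      intro lam _
      rw [Subsingleton.elim lam (Nat.Partition.indiscrete 1)]
      decide
    rw [h1, h2]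
  · rw [C_eq_crankGe, Finset.filter_congr (fun lam _ => crank_pos_iff lam),
      card_filter_partition n (fun μ => μ.count 1 < above (μ.count 1) μ), crankGe,
      ← partCount_above_le_eq (Or.inr hn), numPartitions, add_comm,
      ← partCount_add_partCount_not n (fun μ => above (μ.count 1 + 0) μ ≤ μ.count 1)]
    simp only [add_zero, not_le]

lemma extend_D (x : ℤ) : extend D x = extend numPartitions x - extend C x := by
  unfold extend
  split_ifs with h
  · rw [← D_add_C]
    push_cast
    ring
  · simp

/-! ### Parts that occur at least `m` times -/

lemma s_eq_sum {m : ℕ} (hm : 1 ≤ m) (n : ℕ) {K : ℕ} (hK : n < K) :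
    (s m n : ℤ) =
      ∑ a ∈ Finset.range K, (a : ℤ) * extend numPartitions ((n : ℤ) - (m : ℤ) * a) := by
  have h1 : ∀ lam : n.Partition, ∑ a ∈ lam.parts.toFinset with m ≤ lam.parts.count a, a =
      ∑ a ∈ Finset.range K, if m ≤ lam.parts.count a then a else 0 := by
    intro lam
    rw [← Finset.sum_filter]
    refine Finset.sum_congr ?_ (fun _ _ => rfl)
    ext a
    simp only [Finset.mem_filter, Multiset.mem_toFinset, Finset.mem_range]
    refine and_congr_left (fun ha => ⟨fun h => ?_, fun _ => ?_⟩)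
    · have := Multiset.le_sum_of_mem h
      rw [lam.parts_sum] at this
      omega
    · exact Multiset.count_pos.1 (by omega)
  rw [s, Finset.sum_congr rfl (fun lam _ => h1 lam), Finset.sum_comm, Nat.cast_sum]
  refine Finset.sum_congr rfl (fun a _ => ?_)
  rcases Nat.eq_zero_or_pos a with rfl | ha
  · simp
  rw [← Finset.sum_filter, Finset.sum_const, smul_eq_mul, Nat.cast_mul, mul_comm, ← Nat.cast_mul m,
    extend_sub_natCast, card_filter_partition n (fun μ => m ≤ μ.count a),
    partCount_congr (Q := fun μ => m ≤ μ.count a ∧ True) (fun μ _ _ => by rw [and_true])]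
  split_ifs with h
  · obtain ⟨y, rfl⟩ := Nat.exists_eq_add_of_le' h
    rw [Nat.add_sub_cancel, ← partCount_add_replicate y m a ha (fun _ => True), numPartitions]
  · rw [partCount_le_count_of_lt (by omega), Nat.cast_zero]

lemma extend_s {m : ℕ} (hm : 1 ≤ m) (x : ℤ) {K : ℕ} (hK : x < K) :
    extend (s m) x = ∑ a ∈ Finset.range K, (a : ℤ) * extend numPartitions (x - (m : ℤ) * a) := by
  rcases lt_or_ge x 0 with hx | hx
  · rw [extend_of_neg _ hx, Finset.sum_eq_zero]
    intro a _
    rw [extend_of_neg _ (by have : 0 ≤ (m : ℤ) * a := by positivity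
                            omega), mul_zero]
  · lift x to ℕ using hx
    rw [extend_natCast, s_eq_sum hm x (Nat.cast_lt.1 hK)]

lemma finsum_eq_sum_range {g : ℕ → ℤ} {K : ℕ} (h : ∀ j, K ≤ j → g j = 0) :
    ∑ᶠ j, g j = ∑ j ∈ Finset.range K, g j := by
  refine finsum_eq_sum_of_support_subset g (fun j hj => ?_)
  by_contra hj'
  exact hj (h j (by simpa using hj'))

lemma finsum_mul_extend (f : ℕ → ℕ) {m : ℕ} (hm : 1 ≤ m) (n : ℕ) :
    ∑ᶠ j : ℕ, (j : ℤ) * extend f ((n : ℤ) - (m : ℤ) * (j : ℤ)) =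
      ∑ j ∈ Finset.range (n + 1), (j : ℤ) * extend f ((n : ℤ) - (m : ℤ) * (j : ℤ)) := by
  refine finsum_eq_sum_range (fun j hj => ?_)
  rw [extend_of_neg, mul_zero]
  have : (j : ℤ) ≤ (m : ℤ) * j := by
    exact_mod_cast Nat.le_mul_of_pos_left j hm
  omega

lemma alternating_extend_eq_zero (f : ℕ → ℕ) {n j : ℕ} (hj : n + 1 ≤ j) (c : ℤ) :
    c * extend f ((n : ℤ) - (j : ℤ) * ((j : ℤ) + 1) / 2) = 0 := by
  rw [extend_of_neg _ (by have := le_triangle j; omega), mul_zero]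

/-- The first identity, with both sums cut off at indices beyond which all terms vanish. -/
theorem sum_alternating_s {m : ℕ} (hm : 1 ≤ m) (n : ℕ) :
    ∑ j ∈ Finset.range (n + 1),
        (-1 : ℤ) ^ j * extend (s m) ((n : ℤ) - (j : ℤ) * ((j : ℤ) + 1) / 2) =
      ∑ j ∈ Finset.range (n + 1), (j : ℤ) * extend C ((n : ℤ) - (m : ℤ) * (j : ℤ)) := by
  have hC : C = crankGe 0 := funext C_eq_crankGe
  have h1 : ∀ j ∈ Finset.range (n + 1),
      (-1 : ℤ) ^ j * extend (s m) ((n : ℤ) - (j : ℤ) * ((j : ℤ) + 1) / 2) =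
        ∑ a ∈ Finset.range (n + 1), (a : ℤ) * ((-1 : ℤ) ^ j *
          extend numPartitions ((n : ℤ) - (m : ℤ) * a - (j : ℤ) * ((j : ℤ) + 1) / 2)) := by
    intro j _
    rw [extend_s hm _ (K := n + 1) (by have := le_triangle j; push_cast; omega), Finset.mul_sum]
    refine Finset.sum_congr rfl (fun a _ => ?_)
    rw [sub_right_comm]
    ring
  rw [Finset.sum_congr rfl h1, Finset.sum_comm, hC]
  refine Finset.sum_congr rfl (fun a _ => ?_)
  rw [extend_crankGe_zero _ (K := n + 1) (by
    have : 0 ≤ (m : ℤ) * a := by positivity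
    push_cast
    omega), Finset.mul_sum]

end CrankIdentity

theorem mainTheorem12 (m n : ℕ) (hm : 1 ≤ m) :
    (∑ᶠ j : ℕ, (-1 : ℤ) ^ j *
        CrankIdentity.extend (CrankIdentity.s m) ((n : ℤ) - (j : ℤ) * ((j : ℤ) + 1) / 2)
      = ∑ᶠ j : ℕ, (j : ℤ) * CrankIdentity.extend CrankIdentity.C ((n : ℤ) - (m : ℤ) * (j : ℤ))) ∧
    (∑ᶠ j ∈ Set.Ici (1 : ℕ), (-1 : ℤ) ^ (j + 1) *
        CrankIdentity.extend (CrankIdentity.s m) ((n : ℤ) - (j : ℤ) * ((j : ℤ) + 1) / 2)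
      = ∑ᶠ j : ℕ, (j : ℤ) * CrankIdentity.extend CrankIdentity.D ((n : ℤ) - (m : ℤ) * (j : ℤ))) := by
  have hi := CrankIdentity.sum_alternating_s hm n
  rw [CrankIdentity.finsum_mul_extend _ hm, CrankIdentity.finsum_mul_extend _ hm,
    CrankIdentity.finsum_eq_sum_range
      (fun j hj => CrankIdentity.alternating_extend_eq_zero (CrankIdentity.s m) hj _)]
  refine ⟨hi, ?_⟩
  rw [finsum_mem_def, CrankIdentity.finsum_eq_sum_range (K := n + 1) (fun j hj => by
    rw [Set.indicator_apply_eq_zero]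
    exact fun _ => CrankIdentity.alternating_extend_eq_zero (CrankIdentity.s m) hj _)]
  -- The second identity is the difference of the definition of `s m n` and the first one.
  simp only [CrankIdentity.extend_D, mul_sub, Finset.sum_sub_distrib]
  rw [← hi, ← CrankIdentity.s_eq_sum hm n (Nat.lt_succ_self n), Finset.sum_range_succ',
    Finset.sum_range_succ']
  simp [pow_succ, CrankIdentity.extend_natCast]
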